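/- Let $R_1,\dots,R_K$ be $d'\times d'$ density matrices (positive semidefinite complex matrices of trace one), let $X_1,\dots,X_K$ be a POVM on $\mathbb{C}^{d}$ (so $X_k\ge 0$ and $\sum_{k=1}^K X_k=I$), and let $\Phi$ be the channel $\Phi(\rho)=\sum_{k=1}^K R_k\,\mathrm{Tr}(X_k\rho)$ from $d\times d$ to $d'\times d'$ matrices. Let $\rho_{12}$ be a density matrix on $\mathbb{C}^{d}\otimes\mathbb{C}^{n}$, and let $I$ also denote the identity map on $n\times n$ matrices. Put $$x_k=\mathrm{Tr}\,[(X_k\otimes I)\rho_{12}],\qquad G_k=x_k^{-1}\,\mathrm{Tr}_1[(X_k\otimes I)\rho_{12}],$$ where $\mathrm{Tr}_1$ is the partial trace over the first tensor factor (if $x_k=0$, $G_k$ may be any $n\times n$ matrix), so that $(\Phi\otimes I)(\rho_{12})=\sum_{k=1}^K x_kR_k\otimes G_k$. Let $R=\big((x_1R_1)^{1/2},\dots,(x_KR_K)^{1/2}\big)$, a $1\times K$ block row with $d'\times d'$ blocks. Then for all real $p\ge 1$, $$\mathrm{Tr}\Big((\Phi\otimes I)(\rho_{12})\Big)^p\le\sum_{k=1}^K\mathrm{Tr}\,[(R^*R)^p]_{kk}\;\mathrm{Tr}\,[(G_k)^p],$$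 where $[(R^*R)^p]_{kk}$ is the $k$-th $d'\times d'$ diagonal block of the $K\times K$ block matrix $(R^*R)^p$, and, for $x_k=0$, the $k$-th term of the sum, in which $[(R^*R)^p]_{kk}=0$, is zero. -/

import Mathlib

open scoped ComplexOrder MatrixOrder Kronecker

namespace EBChannel

/-- A density matrix: positive semidefinite with trace one. -/
structure IsDensity {n : Type*} [Fintype n] (ρ : Matrix n n ℂ) : Prop where
  posSemidef : ρ.PosSemidef
  trace_eq_one : ρ.trace = 1

/-- A positive operator valued measure with finitely many outcomes `κ`. -/
structure IsPOVM {m κ : Type*} [Fintype m] [DecidableEq m] [Fintype κ]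
    (X : κ → Matrix m m ℂ) : Prop where
  posSemidef : ∀ k, (X k).PosSemidef
  sum_eq_one : ∑ k, X k = 1

/-- The channel `Φ(ρ) = ∑ k, Tr (X k ρ) R k` in Holevo form. -/
def holevoMap {m m' κ : Type*} [Fintype m] [Fintype κ]
    (R : κ → Matrix m' m' ℂ) (X : κ → Matrix m m ℂ) :
    Matrix m m ℂ →ₗ[ℂ] Matrix m' m' ℂ where
  toFun ρ := ∑ k, (X k * ρ).trace • R k
  map_add' ρ σ := by
    simp [Matrix.mul_add, Matrix.trace_add, add_smul, Finset.sum_add_distrib]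
  map_smul' c ρ := by
    simp [Matrix.trace_smul, Finset.smul_sum, mul_smul]

/-- The map `Φ ⊗ I`, with `I` the identity map on `n × n` matrices, transported along the
Kronecker identification of `(m × n) × (m × n)` matrices with a tensor product. -/
noncomputable def tensorId {m m' : Type*} (n : Type*) [Fintype m] [DecidableEq m]
    [Fintype m'] [DecidableEq m'] [Fintype n] [DecidableEq n]
    (Φ : Matrix m m ℂ →ₗ[ℂ] Matrix m' m' ℂ) :
    Matrix (m × n) (m × n) ℂ →ₗ[ℂ] Matrix (m' × n) (m' × n) ℂ :=
  (kroneckerLinearEquiv m' m' n n ℂ).toLinearMap ∘ₗ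
    TensorProduct.map Φ (LinearMap.id : Matrix n n ℂ →ₗ[ℂ] Matrix n n ℂ) ∘ₗ
      (kroneckerLinearEquiv m m n n ℂ).symm.toLinearMap

/-- The partial trace `Tr₁` over the first tensor factor. -/
def partialTraceLeft {m n : Type*} [Fintype m] (ρ : Matrix (m × n) (m × n) ℂ) : Matrix n n ℂ :=
  Matrix.of fun a b => ∑ i, ρ (i, a) (i, b)

/-- The `1 × K` block row `((x₁ R₁)^(1/2), …, (x_K R_K)^(1/2))`: the entry in row `i` of column
`j` of block `k` is the `(i, j)` entry of `(x k • R k) ^ (1/2)`. -/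
noncomputable def blockRow {m' κ : Type*} [Fintype m'] [DecidableEq m']
    (x : κ → ℂ) (R : κ → Matrix m' m' ℂ) : Matrix m' (κ × m') ℂ :=
  Matrix.of fun i q => ((x q.1 • R q.1) ^ (1 / 2 : ℝ)) i q.2

/-- The `k`-th diagonal block of a `K × K` block matrix. -/
def diagBlock {m' κ : Type*} (A : Matrix (κ × m') (κ × m') ℂ) (k : κ) : Matrix m' m' ℂ :=
  Matrix.of fun i j => A (k, i) (k, j)

end EBChannel

/-! With `T = 1 ⊗ R` and `A` block diagonal with blocks `G k`, the output of `Φ ⊗ I` is `T A T*`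
after swapping tensor factors. As `Y Y*` and `Y* Y` have the same trace of `p`-th powers,
Araki-Lieb-Thirring bounds the left side by `Tr A^p (T* T)^p`. Here `A^p` is again block diagonal
and `(T* T)^p = 1 ⊗ (R* R)^p`, so this trace is exactly the claimed sum.

Araki-Lieb-Thirring (`PosSemidef.trace_rpow_le`) comes from the three lines theorem. With `H =
A^(1/2) B A^(1/2)`, take `f z = Tr A^(pz/2) B^(pz) A^(pz/2) H^(p-pz)`. Imaginary powers are
contractions, so `|f|` is at most `N = Tr H^p` on `re z = 0` and `M = Tr A^p B^p` on `re z = 1`,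
while `f (1/p) = N`. Hence `N ≤ N^(1-1/p) M^(1/p)`, that is `N ≤ M`. -/

namespace Matrix

/-! ### Hilbert-Schmidt estimates -/

section HilbertSchmidt

variable {m n : Type*} [Fintype m] [Fintype n]

/-- The squared Hilbert-Schmidt norm of a matrix. -/
noncomputable def hsNormSq (X : Matrix m n ℂ) : ℝ := ∑ i, ∑ j, ‖X i j‖ ^ 2

lemma hsNormSq_nonneg (X : Matrix m n ℂ) : 0 ≤ hsNormSq X :=
  Finset.sum_nonneg fun _ _ => Finset.sum_nonneg fun _ _ => sq_nonneg _

lemma hsNormSq_conjTranspose (X : Matrix m n ℂ) : hsNormSq Xᴴ = hsNormSq X := by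
  unfold hsNormSq
  rw [Finset.sum_comm]
  simp

lemma trace_conjTranspose_mul_self_eq_hsNormSq (X : Matrix m n ℂ) :
    (Xᴴ * X).trace = (hsNormSq X : ℂ) := by
  unfold hsNormSq
  rw [Finset.sum_comm]
  simp [trace, mul_apply, Complex.conj_mul']

/-- With a common bound for both factors, entrywise AM-GM replaces Cauchy-Schwarz. -/
lemma norm_trace_mul_le {X : Matrix m n ℂ} {Y : Matrix n m ℂ} {c : ℝ}
    (hX : hsNormSq X ≤ c) (hY : hsNormSq Y ≤ c) : ‖(X * Y).trace‖ ≤ c := by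
  have h : ‖(X * Y).trace‖ ≤ ∑ i, ∑ j, (‖X i j‖ ^ 2 + ‖Y j i‖ ^ 2) / 2 := by
    simp only [trace, diag_apply, mul_apply]
    refine (norm_sum_le _ _).trans (Finset.sum_le_sum fun i _ => ?_)
    refine (norm_sum_le _ _).trans (Finset.sum_le_sum fun j _ => ?_)
    rw [norm_mul]
    linarith [two_mul_le_add_sq ‖X i j‖ ‖Y j i‖]
  have h2 : ∑ i, ∑ j, (‖X i j‖ ^ 2 + ‖Y j i‖ ^ 2) / 2 = (hsNormSq X + hsNormSq Y) / 2 := by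
    unfold hsNormSq
    rw [Finset.sum_comm (f := fun j i => ‖Y j i‖ ^ 2)]
    simp_rw [← Finset.sum_div, Finset.sum_add_distrib]
  linarith

lemma hsNormSq_mul_le [DecidableEq m] {W : Matrix m m ℂ} (hW : (1 - Wᴴ * W).PosSemidef)
    (X : Matrix m n ℂ) : hsNormSq (W * X) ≤ hsNormSq X := by
  have h := (hW.conjTranspose_mul_mul_same X).trace_nonneg
  have e : (Xᴴ * (1 - Wᴴ * W) * X).trace = (hsNormSq X : ℂ) - hsNormSq (W * X) := by
    rw [← trace_conjTranspose_mul_self_eq_hsNormSq, ← trace_conjTranspose_mul_self_eq_hsNormSq,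
      ← trace_sub, conjTranspose_mul]
    congr 1
    simp [Matrix.mul_sub, Matrix.sub_mul, Matrix.mul_assoc]
  rw [e, ← Complex.ofReal_sub] at h
  exact sub_nonneg.mp (Complex.zero_le_real.mp h)

end HilbertSchmidt

/-! ### Complex powers of Hermitian matrices -/

section Spectral

variable {m n : Type*} [Fintype m] [Fintype n] [DecidableEq n] {A : Matrix n n ℂ}

/-- The complex-valued functional calculus of a Hermitian matrix. -/
noncomputable def IsHermitian.spectralMap (hA : A.IsHermitian) (g : ℝ → ℂ) : Matrix n n ℂ :=
  (hA.eigenvectorUnitary : Matrix n n ℂ) * diagonal (fun i => g (hA.eigenvalues i)) *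
    (hA.eigenvectorUnitary : Matrix n n ℂ)ᴴ

namespace IsHermitian

lemma conjTranspose_spectralMap (hA : A.IsHermitian) (g : ℝ → ℂ) :
    (hA.spectralMap g)ᴴ = hA.spectralMap (fun x => star (g x)) := by
  simp only [spectralMap, conjTranspose_mul, conjTranspose_conjTranspose, diagonal_conjTranspose,
    Matrix.mul_assoc]
  rfl

lemma spectralMap_mul (hA : A.IsHermitian) (g h : ℝ → ℂ) :
    hA.spectralMap g * hA.spectralMap h = hA.spectralMap (fun x => g x * h x) := by
  have hU : (hA.eigenvectorUnitary : Matrix n n ℂ)ᴴ * (hA.eigenvectorUnitary : Matrix n n ℂ) = 1 :=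
    Unitary.coe_star_mul_self hA.eigenvectorUnitary
  have e : ∀ U D E : Matrix n n ℂ, U * D * Uᴴ * (U * E * Uᴴ) = U * D * (Uᴴ * U) * E * Uᴴ := by
    intros; simp only [Matrix.mul_assoc]
  rw [spectralMap, spectralMap, e, hU, Matrix.mul_one, Matrix.mul_assoc _ (diagonal _) (diagonal _),
    diagonal_mul_diagonal, spectralMap]

lemma spectralMap_one (hA : A.IsHermitian) : hA.spectralMap (fun _ => 1) = 1 := by
  have hU : (hA.eigenvectorUnitary : Matrix n n ℂ) * (hA.eigenvectorUnitary : Matrix n n ℂ)ᴴ = 1 :=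
    Unitary.coe_mul_star_self hA.eigenvectorUnitary
  rw [spectralMap, diagonal_one, Matrix.mul_one, hU]

lemma spectralMap_sub (hA : A.IsHermitian) (g h : ℝ → ℂ) :
    hA.spectralMap g - hA.spectralMap h = hA.spectralMap (fun x => g x - h x) := by
  simp only [spectralMap, ← Matrix.sub_mul, ← Matrix.mul_sub, diagonal_sub]

lemma posSemidef_spectralMap (hA : A.IsHermitian) {g : ℝ → ℂ} (hg : ∀ x, 0 ≤ g x) :
    (hA.spectralMap g).PosSemidef :=
  (PosSemidef.diagonal fun _ => hg _).mul_mul_conjTranspose_same _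

lemma cfc_eq_spectralMap (hA : A.IsHermitian) (f : ℝ → ℝ) :
    cfc f A = hA.spectralMap (fun x => (f x : ℂ)) := by
  rw [hA.cfc_eq, IsHermitian.cfc, Unitary.conjStarAlgAut_apply]
  rfl

lemma hsNormSq_spectralMap_mul_le (hA : A.IsHermitian) {g : ℝ → ℂ} (hg : ∀ x, ‖g x‖ ≤ 1)
    (X : Matrix n m ℂ) : hsNormSq (hA.spectralMap g * X) ≤ hsNormSq X := by
  refine hsNormSq_mul_le ?_ X
  rw [conjTranspose_spectralMap, spectralMap_mul, ← hA.spectralMap_one, spectralMap_sub]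
  refine hA.posSemidef_spectralMap fun x => ?_
  have : star (g x) * g x = ((‖g x‖ ^ 2 : ℝ) : ℂ) := by
    simpa using Complex.conj_mul' (g x)
  rw [this, ← Complex.ofReal_one, ← Complex.ofReal_sub, Complex.zero_le_real]
  nlinarith [hg x, norm_nonneg (g x)]

lemma hsNormSq_mul_spectralMap_le (hA : A.IsHermitian) {g : ℝ → ℂ} (hg : ∀ x, ‖g x‖ ≤ 1)
    (X : Matrix m n ℂ) : hsNormSq (X * hA.spectralMap g) ≤ hsNormSq X := by
  rw [← hsNormSq_conjTranspose, conjTranspose_mul, conjTranspose_spectralMap,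
    ← hsNormSq_conjTranspose X]
  exact hA.hsNormSq_spectralMap_mul_le (by simpa using hg) _

end IsHermitian

/-- The complex power `x ^ w` of a positive real, extended by zero to `x ≤ 0`. -/
noncomputable def posCpow (w : ℂ) (x : ℝ) : ℂ :=
  if 0 < x then Complex.exp (w * Real.log x) else 0

/-- Extension by zero keeps the exponent law valid on the kernel, so no invertibility is needed;
exponent `0` gives the projection onto the positive spectral part. -/
lemma posCpow_add (v w : ℂ) (x : ℝ) : posCpow (v + w) x = posCpow v x * posCpow w x := by
  unfold posCpow
  split_ifs
  · rw [add_mul, Complex.exp_add]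
  · simp

lemma posCpow_ofReal {r : ℝ} (hr : 0 < r) {x : ℝ} (hx : 0 ≤ x) :
    posCpow r x = ((x ^ r : ℝ) : ℂ) := by
  unfold posCpow
  rcases hx.eq_or_lt with rfl | hx
  · simp [Real.zero_rpow hr.ne']
  · rw [if_pos hx, Real.rpow_def_of_pos hx]
    push_cast
    rw [mul_comm]

lemma star_posCpow_ofReal (r x : ℝ) : star (posCpow r x) = posCpow r x := by
  unfold posCpow
  split_ifs
  · rw [← Complex.ofReal_mul, ← Complex.ofReal_exp]
    exact Complex.conj_ofReal _
  · simp

lemma norm_posCpow_le_one {w : ℂ} (hw : w.re = 0) (x : ℝ) : ‖posCpow w x‖ ≤ 1 := by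
  unfold posCpow
  split_ifs
  · simp [Complex.norm_exp, hw]
  · simp

lemma IsHermitian.spectralMap_congr (hA : A.IsHermitian) {g h : ℝ → ℂ}
    (H : ∀ i, g (hA.eigenvalues i) = h (hA.eigenvalues i)) :
    hA.spectralMap g = hA.spectralMap h := by
  simp only [spectralMap, H]

lemma IsHermitian.spectralMap_posCpow_add (hA : A.IsHermitian) (v w : ℂ) :
    hA.spectralMap (posCpow (v + w)) = hA.spectralMap (posCpow v) * hA.spectralMap (posCpow w) := by
  rw [spectralMap_mul]
  exact hA.spectralMap_congr fun i => posCpow_add _ _ _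

lemma PosSemidef.rpow_eq_spectralMap (hA : A.PosSemidef) {p : ℝ} (hp : 0 < p) :
    A ^ p = hA.isHermitian.spectralMap (posCpow p) := by
  rw [CFC.rpow_eq_cfc_real (nonneg_iff_posSemidef.mpr hA), hA.isHermitian.cfc_eq_spectralMap]
  exact hA.isHermitian.spectralMap_congr fun i => (posCpow_ofReal hp (hA.eigenvalues_nonneg i)).symm

lemma PosSemidef.spectralMap_posCpow_one (hA : A.PosSemidef) :
    hA.isHermitian.spectralMap (posCpow 1) = A := by
  have := hA.rpow_eq_spectralMap one_pos
  rw [CFC.rpow_one A (nonneg_iff_posSemidef.mpr hA)] at this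
  exact_mod_cast this.symm

lemma IsHermitian.conjTranspose_spectralMap_posCpow_ofReal (hA : A.IsHermitian) (r : ℝ) :
    (hA.spectralMap (posCpow r))ᴴ = hA.spectralMap (posCpow r) := by
  rw [conjTranspose_spectralMap]
  exact hA.spectralMap_congr fun i => star_posCpow_ofReal _ _

end Spectral

/-! ### Three lines theorem on the strip -/

section Interpolation

/-- Entire functions that are bounded on the strip `0 ≤ re z ≤ 1`. -/
def IsStripBounded (f : ℂ → ℂ) : Prop :=
  Differentiable ℂ f ∧ ∃ C, ∀ z : ℂ, 0 ≤ z.re → z.re ≤ 1 → ‖f z‖ ≤ C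

namespace IsStripBounded

lemma const (c : ℂ) : IsStripBounded fun _ => c :=
  ⟨differentiable_const c, ‖c‖, fun _ _ _ => le_rfl⟩

lemma mul {f g : ℂ → ℂ} (hf : IsStripBounded f) (hg : IsStripBounded g) :
    IsStripBounded fun z => f z * g z := by
  obtain ⟨hf, C, hC⟩ := hf
  obtain ⟨hg, D, hD⟩ := hg
  refine ⟨hf.mul hg, C * D, fun z h0 h1 => ?_⟩
  rw [norm_mul]
  exact mul_le_mul (hC z h0 h1) (hD z h0 h1) (norm_nonneg _) ((norm_nonneg _).trans (hC z h0 h1))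

lemma sum {ι : Type*} {s : Finset ι} {f : ι → ℂ → ℂ} (hf : ∀ i, IsStripBounded (f i)) :
    IsStripBounded fun z => ∑ i ∈ s, f i z := by
  choose hd C hC using hf
  refine ⟨Differentiable.fun_sum fun i _ => hd i, ∑ i ∈ s, C i, fun z h0 h1 => ?_⟩
  exact (norm_sum_le _ _).trans (Finset.sum_le_sum fun i _ => hC i z h0 h1)

lemma posCpow (a b x : ℝ) : IsStripBounded fun z => posCpow (a * z + b) x := by
  by_cases hx : 0 < x
  · simp only [Matrix.posCpow, if_pos hx]
    refine ⟨by fun_prop, Real.exp ((|a| + |b|) * |Real.log x|), fun z h0 h1 => ?_⟩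
    rw [Complex.norm_exp, Real.exp_le_exp]
    have e : ((a * z + b) * (Real.log x : ℂ)).re = (a * z.re + b) * Real.log x := by simp
    rw [e]
    refine (le_abs_self _).trans ?_
    rw [abs_mul]
    refine mul_le_mul_of_nonneg_right ((abs_add_le _ _).trans ?_) (abs_nonneg _)
    rw [abs_mul, abs_of_nonneg h0]
    exact add_le_add_left (mul_le_of_le_one_right (abs_nonneg a) h1) _
  · simpa only [Matrix.posCpow, if_neg hx] using const 0

lemma matrix_mul {l m n : Type*} [Fintype m] {F : ℂ → Matrix l m ℂ} {G : ℂ → Matrix m n ℂ}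
    (hF : ∀ i j, IsStripBounded fun z => F z i j) (hG : ∀ i j, IsStripBounded fun z => G z i j)
    (i : l) (j : n) : IsStripBounded fun z => (F z * G z) i j := by
  simp only [mul_apply]
  exact sum fun k => (hF i k).mul (hG k j)

lemma spectralMap {n : Type*} [Fintype n] [DecidableEq n] {A : Matrix n n ℂ}
    (hA : A.IsHermitian) (a b : ℝ) (i j : n) :
    IsStripBounded fun z => hA.spectralMap (Matrix.posCpow (a * z + b)) i j := by
  refine matrix_mul
    (F := fun z => (hA.eigenvectorUnitary : Matrix n n ℂ) *
      diagonal fun k => Matrix.posCpow (a * z + b) (hA.eigenvalues k))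
    (G := fun _ => (hA.eigenvectorUnitary : Matrix n n ℂ)ᴴ)
    (matrix_mul (F := fun _ => (hA.eigenvectorUnitary : Matrix n n ℂ))
      (fun _ _ => const _) fun k l => ?_) (fun _ _ => const _) i j
  by_cases h : k = l
  · subst h
    simpa only [diagonal_apply_eq] using posCpow a b _
  · simpa only [diagonal_apply_ne _ h] using const 0

lemma norm_le_interp {f : ℂ → ℂ} (hf : IsStripBounded f) {a b : ℝ}
    (ha : ∀ z : ℂ, z.re = 0 → ‖f z‖ ≤ a) (hb : ∀ z : ℂ, z.re = 1 → ‖f z‖ ≤ b)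
    {θ : ℝ} (h0 : 0 ≤ θ) (h1 : θ ≤ 1) : ‖f θ‖ ≤ a ^ (1 - θ) * b ^ θ := by
  obtain ⟨hd, C, hC⟩ := hf
  have := Complex.HadamardThreeLines.norm_le_interp_of_mem_verticalClosedStrip' (f := f)
    (z := (θ : ℂ)) (a := a) (b := b) zero_lt_one (by
      simpa [Complex.HadamardThreeLines.verticalClosedStrip] using ⟨h0, h1⟩) hd.diffContOnCl
    ⟨C, by
      rintro _ ⟨z, hz, rfl⟩
      exact hC z hz.1 hz.2⟩ (fun z hz => ha z hz) (fun z hz => hb z hz)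
  simpa using this

end IsStripBounded

end Interpolation

end Matrix

/-! ### Araki-Lieb-Thirring by interpolation -/

namespace Matrix

variable {n : Type*} [Fintype n] [DecidableEq n]

lemma IsHermitian.trace_spectralMap_posCpow {A : Matrix n n ℂ} (hA : A.IsHermitian) (p : ℝ) :
    (hA.spectralMap (posCpow p)).trace =
      (hsNormSq (hA.spectralMap (posCpow (p / 2 : ℝ))) : ℂ) := by
  rw [← trace_conjTranspose_mul_self_eq_hsNormSq, hA.conjTranspose_spectralMap_posCpow_ofReal,
    ← hA.spectralMap_posCpow_add, ← Complex.ofReal_add, add_halves]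

/-- The Araki-Lieb-Thirring inequality. -/
theorem PosSemidef.trace_rpow_le {A B : Matrix n n ℂ} (hA : A.PosSemidef) (hB : B.PosSemidef)
    {p : ℝ} (hp : 1 ≤ p) :
    ((A ^ (1 / 2 : ℝ) * B * A ^ (1 / 2 : ℝ)) ^ p).trace ≤ (A ^ p * B ^ p).trace := by
  have hp0 : 0 < p := by linarith
  have hAh := hA.isHermitian
  have hBh := hB.isHermitian
  set S := hAh.spectralMap (posCpow (1 / 2 : ℝ)) with hS
  have hSs : Sᴴ = S := hAh.conjTranspose_spectralMap_posCpow_ofReal _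
  have hH : (S * B * S).PosSemidef := by
    have := hB.mul_mul_conjTranspose_same S
    rwa [hSs] at this
  rw [hA.rpow_eq_spectralMap (by norm_num : (0 : ℝ) < 1 / 2), ← hS, hH.rpow_eq_spectralMap hp0,
    hA.rpow_eq_spectralMap hp0, hB.rpow_eq_spectralMap hp0]
  have hHh := hH.isHermitian
  set a : ℂ → Matrix n n ℂ := fun w => hAh.spectralMap (posCpow w)
  set b : ℂ → Matrix n n ℂ := fun w => hBh.spectralMap (posCpow w)
  set h : ℂ → Matrix n n ℂ := fun w => hHh.spectralMap (posCpow w)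
  have a_add : ∀ v w, a (v + w) = a v * a w := fun v w => hAh.spectralMap_posCpow_add v w
  have b_add : ∀ v w, b (v + w) = b v * b w := fun v w => hBh.spectralMap_posCpow_add v w
  have h_add : ∀ v w, h (v + w) = h v * h w := fun v w => hHh.spectralMap_posCpow_add v w
  set N := hsNormSq (h (p / 2 : ℝ))
  set M := hsNormSq (a (p / 2 : ℝ) * b (p / 2 : ℝ)) with hM
  have hN0 : 0 ≤ N := hsNormSq_nonneg _
  have hM0 : 0 ≤ M := hsNormSq_nonneg _
  have eN : (h p).trace = (N : ℂ) := hHh.trace_spectralMap_posCpow p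
  have hba : hsNormSq (b (p / 2 : ℝ) * a (p / 2 : ℝ)) = M := by
    rw [hM, ← hsNormSq_conjTranspose, conjTranspose_mul,
      hAh.conjTranspose_spectralMap_posCpow_ofReal, hBh.conjTranspose_spectralMap_posCpow_ofReal]
  have halves : (p : ℂ) = ((p / 2 : ℝ) : ℂ) + ((p / 2 : ℝ) : ℂ) := by push_cast; ring
  have eM : (a p * b p).trace = (M : ℂ) := by
    rw [← hba, ← trace_conjTranspose_mul_self_eq_hsNormSq, conjTranspose_mul,
      hAh.conjTranspose_spectralMap_posCpow_ofReal, hBh.conjTranspose_spectralMap_posCpow_ofReal]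
    change _ = (a (p / 2 : ℝ) * b (p / 2 : ℝ) * (b (p / 2 : ℝ) * a (p / 2 : ℝ))).trace
    rw [halves, a_add, b_add, Matrix.mul_assoc, trace_mul_comm]
    simp only [Matrix.mul_assoc]
  change (h p).trace ≤ (a p * b p).trace
  rw [eN, eM, Complex.real_le_real]
  -- The added `(0 : ℝ)` puts every exponent in the affine form of `IsStripBounded.spectralMap`.
  let f : ℂ → ℂ := fun z =>
    (a ((p / 2 : ℝ) * z + (0 : ℝ)) * b (p * z + (0 : ℝ)) * a ((p / 2 : ℝ) * z + (0 : ℝ)) *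
      h ((-p : ℝ) * z + p)).trace
  have hf : IsStripBounded f := by
    have ha' (i j) : IsStripBounded fun z => a ((p / 2 : ℝ) * z + (0 : ℝ)) i j :=
      .spectralMap hAh _ _ i j
    have hb' (i j) : IsStripBounded fun z => b (p * z + (0 : ℝ)) i j := .spectralMap hBh _ _ i j
    have hh' (i j) : IsStripBounded fun z => h ((-p : ℝ) * z + p) i j := .spectralMap hHh _ _ i j
    exact IsStripBounded.sum fun i =>
      IsStripBounded.matrix_mul (IsStripBounded.matrix_mul (IsStripBounded.matrix_mul ha' hb') ha')
        hh' i i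
  have hfz (z : ℂ) : f z = (a ((p / 2 : ℝ) * z) * b (p * z) * a ((p / 2 : ℝ) * z) *
      h ((-p : ℝ) * z + p)).trace := by
    simp only [f, Complex.ofReal_zero, add_zero]
  have f0 : ∀ z : ℂ, z.re = 0 → ‖f z‖ ≤ N := by
    intro z hz
    -- Half of `H^p` is cycled to the front; every factor between the halves has an imaginary
    -- exponent.
    have e : f z = (h (p / 2 : ℝ) * (a ((p / 2 : ℝ) * z) * (b (p * z) * (a ((p / 2 : ℝ) * z) *
        (h ((-p : ℝ) * z) * h (p / 2 : ℝ)))))).trace := by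
      rw [hfz, h_add, halves, h_add, ← Matrix.mul_assoc, ← Matrix.mul_assoc, trace_mul_comm]
      simp only [Matrix.mul_assoc]
    rw [e]
    refine norm_trace_mul_le le_rfl ?_
    have hre (r : ℝ) : ((r : ℂ) * z).re = 0 := by simp [hz]
    refine (hAh.hsNormSq_spectralMap_mul_le (norm_posCpow_le_one (hre _)) _).trans ?_
    refine (hBh.hsNormSq_spectralMap_mul_le (norm_posCpow_le_one (hre _)) _).trans ?_
    refine (hAh.hsNormSq_spectralMap_mul_le (norm_posCpow_le_one (hre _)) _).trans ?_
    exact hHh.hsNormSq_spectralMap_mul_le (norm_posCpow_le_one (hre _)) _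
  have f1 : ∀ z : ℂ, z.re = 1 → ‖f z‖ ≤ M := by
    intro z hz
    have hre (r : ℝ) : ((r : ℂ) * (z - 1)).re = 0 := by simp [hz]
    -- Writing `z = 1 + (z - 1)` isolates `A^(p/2) B^(p/2)` and its adjoint, up to imaginary powers.
    have e : f z = (a (p / 2 : ℝ) * b (p / 2 : ℝ) * b (p * (z - 1)) *
        (b (p / 2 : ℝ) * a (p / 2 : ℝ) * a ((p / 2 : ℝ) * (z - 1)) * h ((-p : ℝ) * (z - 1)) *
          a ((p / 2 : ℝ) * (z - 1)))).trace := by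
      have e1 : ((p / 2 : ℝ) : ℂ) * z = (p / 2 : ℝ) * (z - 1) + (p / 2 : ℝ) := by ring
      have e1' : ((p / 2 : ℝ) : ℂ) * z = (p / 2 : ℝ) + (p / 2 : ℝ) * (z - 1) := by ring
      have e2 : (p : ℂ) * z = (p / 2 : ℝ) + p * (z - 1) + (p / 2 : ℝ) := by push_cast; ring
      have e3 : ((-p : ℝ) : ℂ) * z + p = (-p : ℝ) * (z - 1) := by push_cast; ring
      have a1 : a ((p / 2 : ℝ) * z) = a ((p / 2 : ℝ) * (z - 1)) * a (p / 2 : ℝ) := by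
        rw [e1, a_add]
      have a2 : a ((p / 2 : ℝ) * z) = a (p / 2 : ℝ) * a ((p / 2 : ℝ) * (z - 1)) := by
        rw [e1', a_add]
      rw [hfz, e2, e3, b_add, b_add]
      nth_rewrite 1 [a1]
      rw [a2]
      simp only [Matrix.mul_assoc]
      rw [trace_mul_comm]
      simp only [Matrix.mul_assoc]
    rw [e]
    refine norm_trace_mul_le ?_ ?_
    · exact hBh.hsNormSq_mul_spectralMap_le (norm_posCpow_le_one (hre _)) _
    · refine (hAh.hsNormSq_mul_spectralMap_le (norm_posCpow_le_one (hre _)) _).trans ?_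
      refine (hHh.hsNormSq_mul_spectralMap_le (norm_posCpow_le_one (hre _)) _).trans ?_
      exact (hAh.hsNormSq_mul_spectralMap_le (norm_posCpow_le_one (hre _)) _).trans hba.le
  have fθ : f (p⁻¹ : ℝ) = N := by
    have hpc : (p : ℂ) ≠ 0 := by exact_mod_cast hp0.ne'
    have e1 : ((p / 2 : ℝ) : ℂ) * (p⁻¹ : ℝ) = (1 / 2 : ℝ) := by push_cast; field_simp
    have e2 : (p : ℂ) * (p⁻¹ : ℝ) = 1 := by push_cast; field_simp
    have e3 : ((-p : ℝ) : ℂ) * (p⁻¹ : ℝ) + p = -1 + p := by push_cast; field_simp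
    have hb1 : b 1 = B := hB.spectralMap_posCpow_one
    have hh1 : h 1 = S * B * S := hH.spectralMap_posCpow_one
    rw [hfz, e1, e2, e3, hb1]
    change (S * B * S * _).trace = _
    rw [← hh1, ← h_add, ← eN]
    ring_nf
  have hi : p⁻¹ ≤ 1 := inv_le_one_of_one_le₀ hp
  have hi0 : 0 ≤ p⁻¹ := inv_nonneg.mpr hp0.le
  clear_value f N M
  have key := hf.norm_le_interp f0 f1 hi0 hi
  rw [fθ, Complex.norm_real, Real.norm_of_nonneg hN0] at key
  -- Cancelling a power of `N` requires `N > 0`.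
  rcases hN0.eq_or_lt with hN1 | hN1
  · rw [← hN1]; exact hM0
  · have h1 : N ^ p⁻¹ ≤ M ^ p⁻¹ := by
      rw [Real.rpow_sub hN1, Real.rpow_one, div_mul_eq_mul_div, le_div_iff₀ (by positivity)] at key
      exact le_of_mul_le_mul_left key hN1
    exact (Real.rpow_le_rpow_iff hN0 hM0 (inv_pos.mpr hp0)).mp h1

end Matrix

/-! ### Real powers as polynomials -/

namespace Matrix

section RpowAeval

open Polynomial

variable {m n : Type*} [Fintype m] [Fintype n] [DecidableEq m] [DecidableEq n]

lemma PosSemidef.rpow_eq_aeval {A : Matrix n n ℂ} (hA : A.PosSemidef) {p : ℝ} {q : ℝ[X]}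
    (hq : ∀ x ∈ spectrum ℝ A, 0 ≤ x → q.eval x = x ^ p) : A ^ p = aeval A q := by
  have h0 : 0 ≤ A := nonneg_iff_posSemidef.mpr hA
  rw [CFC.rpow_eq_cfc_real h0, ← cfc_polynomial q A hA.isHermitian.isSelfAdjoint]
  exact cfc_congr fun x hx => (hq x hx (spectrum_nonneg_of_nonneg h0 hx)).symm

lemma exists_polynomial_eval_eq {s : Set ℝ} (hs : s.Finite) (f : ℝ → ℝ) :
    ∃ q : ℝ[X], ∀ x ∈ s, q.eval x = f x :=
  ⟨Lagrange.interpolate hs.toFinset id f, fun _ hx =>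
    Lagrange.eval_interpolate_at_node f (Function.injective_id.injOn) (hs.mem_toFinset.mpr hx)⟩

/-- Interpolate `x^(p-1)`: the factor `X` gives the correct value `0` at `0`, since `p > 0`. -/
lemma exists_polynomial_eval_X_mul_eq {s : Set ℝ} (hs : s.Finite) {p : ℝ} (hp : 0 < p) :
    ∃ q : ℝ[X], ∀ x ∈ s, 0 ≤ x → (X * q).eval x = x ^ p := by
  obtain ⟨q, hq⟩ := exists_polynomial_eval_eq hs fun x => x ^ (p - 1)
  refine ⟨q, fun x hx h0 => ?_⟩
  rw [eval_mul, eval_X, hq x hx]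
  rcases h0.eq_or_lt with rfl | h
  · rw [zero_mul, Real.zero_rpow hp.ne']
  · rw [Real.rpow_sub_one h.ne', mul_div_cancel₀ _ h.ne']

/-- One polynomial interpolates the power on both spectra, and algebra homomorphisms commute with
polynomials. -/
lemma PosSemidef.map_rpow {A : Matrix n n ℂ} (hA : A.PosSemidef)
    (φ : Matrix n n ℂ →ₐ[ℝ] Matrix m m ℂ) (hφ : (φ A).PosSemidef) (p : ℝ) :
    φ (A ^ p) = φ A ^ p := by
  obtain ⟨q, hq⟩ := exists_polynomial_eval_eq
    ((finite_real_spectrum (A := A)).union (finite_real_spectrum (A := φ A))) fun x => x ^ p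
  rw [hA.rpow_eq_aeval fun x hx _ => hq x (.inl hx), hφ.rpow_eq_aeval fun x hx _ => hq x (.inr hx),
    aeval_algHom_apply]

lemma mul_aeval_mul_comm (A : Matrix m n ℂ) (B : Matrix n m ℂ) (q : ℝ[X]) :
    aeval (A * B) q * A = A * aeval (B * A) q := by
  induction q using Polynomial.induction_on' with
  | add f g hf hg => simp only [map_add, Matrix.add_mul, Matrix.mul_add, hf, hg]
  | monomial k r =>
    simp only [aeval_monomial, Algebra.algebraMap_eq_smul_one, smul_mul, Matrix.mul_smul,
      Matrix.one_mul]
    congr 1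
    induction k with
    | zero => simp
    | succ k ih =>
      rw [pow_succ', pow_succ', Matrix.mul_assoc, ih]
      simp only [Matrix.mul_assoc]

/-- Write the power as `X * q`: then `Y Y* q(Y Y*)` becomes `Y* Y q(Y* Y)` by cyclicity and `q(Y Y*)
Y = Y q(Y* Y)`. -/
lemma trace_rpow_mul_conjTranspose_self (Y : Matrix m n ℂ) {p : ℝ} (hp : 0 < p) :
    ((Y * Yᴴ) ^ p).trace = ((Yᴴ * Y) ^ p).trace := by
  obtain ⟨q, hq⟩ := exists_polynomial_eval_X_mul_eq ((finite_real_spectrum (A := Y * Yᴴ)).union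
    (finite_real_spectrum (A := Yᴴ * Y))) hp
  rw [(posSemidef_self_mul_conjTranspose Y).rpow_eq_aeval fun x hx => hq x (.inl hx),
    (posSemidef_conjTranspose_mul_self Y).rpow_eq_aeval fun x hx => hq x (.inr hx),
    map_mul, map_mul, aeval_X, aeval_X, Matrix.mul_assoc, trace_mul_comm, Matrix.mul_assoc,
    Matrix.mul_assoc, mul_aeval_mul_comm]

lemma PosSemidef.rpow_apply_eq_zero {A : Matrix n n ℂ} (hA : A.PosSemidef) {p : ℝ} (hp : 0 < p)
    {i : n} (hi : ∀ j, A i j = 0) (j : n) : (A ^ p) i j = 0 := by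
  obtain ⟨q, hq⟩ := exists_polynomial_eval_X_mul_eq (finite_real_spectrum (A := A)) hp
  rw [hA.rpow_eq_aeval hq, map_mul, aeval_X, mul_apply]
  simp [hi]

lemma PosSemidef.trace_rpow_submatrix {A : Matrix n n ℂ} (hA : A.PosSemidef) (e : m ≃ n) (p : ℝ) :
    ((A.submatrix e e) ^ p).trace = (A ^ p).trace := by
  have h := hA.map_rpow (reindexAlgEquiv ℝ ℂ e.symm).toAlgHom (hA.submatrix e) p
  change (A ^ p).submatrix e e = (A.submatrix e e) ^ p at h
  rw [← h]
  exact e.sum_comp fun i => (A ^ p) i i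

lemma PosSemidef.one_kronecker_rpow {A : Matrix n n ℂ} (hA : A.PosSemidef) (p : ℝ) :
    ((1 : Matrix m m ℂ) ⊗ₖ A) ^ p = 1 ⊗ₖ (A ^ p) := by
  let φ : Matrix n n ℂ →ₐ[ℝ] Matrix (m × n) (m × n) ℂ :=
    AlgHom.ofLinearMap
      { toFun := fun A => 1 ⊗ₖ A
        map_add' := kronecker_add 1
        map_smul' := fun r A => kronecker_smul r 1 A } one_kronecker_one
      fun A B => by simp [← mul_kronecker_mul]
  exact (hA.map_rpow φ (PosSemidef.one.kronecker hA) p).symm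

lemma posSemidef_blockDiagonal {ι : Type*} [Fintype ι] [DecidableEq ι] {D : ι → Matrix n n ℂ}
    (hD : ∀ i, (D i).PosSemidef) : (blockDiagonal D).PosSemidef := by
  choose C hC using fun i =>
    CStarAlgebra.nonneg_iff_eq_star_mul_self.mp (nonneg_iff_posSemidef.mpr (hD i))
  have : blockDiagonal D = (blockDiagonal C)ᴴ * blockDiagonal C := by
    rw [blockDiagonal_conjTranspose, ← blockDiagonal_mul]
    exact congrArg _ (funext hC)
  rw [this]
  exact posSemidef_conjTranspose_mul_self _

lemma blockDiagonal_rpow {ι : Type*} [Fintype ι] [DecidableEq ι] {D : ι → Matrix n n ℂ}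
    (hD : ∀ i, (D i).PosSemidef) (p : ℝ) :
    blockDiagonal D ^ p = blockDiagonal fun i => D i ^ p := by
  obtain ⟨q, hq⟩ := exists_polynomial_eval_eq
    ((finite_real_spectrum (A := blockDiagonal D)).union
      (Set.finite_iUnion fun i => finite_real_spectrum (A := D i))) fun x => x ^ p
  let φ : (ι → Matrix n n ℂ) →ₐ[ℝ] Matrix (n × ι) (n × ι) ℂ :=
    AlgHom.ofLinearMap
      { toFun := blockDiagonal
        map_add' := blockDiagonal_add
        map_smul' := blockDiagonal_smul } blockDiagonal_one blockDiagonal_mul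
  rw [(posSemidef_blockDiagonal hD).rpow_eq_aeval fun x hx _ => hq x (.inl hx)]
  have h := aeval_algHom_apply φ D q
  change aeval (blockDiagonal D) q = blockDiagonal (aeval D q) at h
  rw [h]
  congr 1
  ext1 i
  rw [(hD i).rpow_eq_aeval fun x hx _ => hq x (.inr (Set.mem_iUnion.mpr ⟨i, hx⟩))]
  exact (aeval_algHom_apply (Pi.evalAlgHom ℝ (fun _ : ι => Matrix n n ℂ) i) D q).symm

end RpowAeval

end Matrix

/-! ### Partial trace and the Holevo form -/

namespace EBChannel

open Matrix

section PartialTrace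

variable {m n : Type*} [Fintype m]

lemma trace_partialTraceLeft [Fintype n] (ρ : Matrix (m × n) (m × n) ℂ) :
    (partialTraceLeft ρ).trace = ρ.trace := by
  simp only [partialTraceLeft, trace, diag_apply, of_apply, Fintype.sum_prod_type]
  exact Finset.sum_comm

lemma posSemidef_partialTraceLeft {ρ : Matrix (m × n) (m × n) ℂ} (hρ : ρ.PosSemidef) :
    (partialTraceLeft ρ).PosSemidef := by
  have : partialTraceLeft ρ = ∑ i, ρ.submatrix (Prod.mk i) (Prod.mk i) := by
    ext a b
    simp [partialTraceLeft, Matrix.sum_apply]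
  rw [this]
  exact posSemidef_sum _ fun i _ => hρ.submatrix _

variable [Fintype n] [DecidableEq n]

lemma partialTraceLeft_kronecker_one_mul_comm (C : Matrix m m ℂ) (ρ : Matrix (m × n) (m × n) ℂ) :
    partialTraceLeft ((C ⊗ₖ (1 : Matrix n n ℂ)) * ρ) = partialTraceLeft (ρ * (C ⊗ₖ 1)) := by
  ext a b
  simp only [partialTraceLeft, of_apply, mul_apply, kroneckerMap_apply, one_apply,
    Fintype.sum_prod_type, mul_ite, mul_one, mul_zero, ite_mul, zero_mul, Finset.sum_ite_eq,
    Finset.sum_ite_eq', Finset.mem_univ, if_true]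
  rw [Finset.sum_comm]
  simp only [mul_comm]

/-- Factor `X = C* C` and cycle `C*` around, leaving the partial trace of `(C ⊗ 1) ρ (C ⊗ 1)*`. -/
lemma posSemidef_partialTraceLeft_kronecker_one_mul [DecidableEq m] {X : Matrix m m ℂ} (hX : X.PosSemidef)
    {ρ : Matrix (m × n) (m × n) ℂ} (hρ : ρ.PosSemidef) :
    (partialTraceLeft ((X ⊗ₖ (1 : Matrix n n ℂ)) * ρ)).PosSemidef := by
  obtain ⟨C, rfl⟩ := CStarAlgebra.nonneg_iff_eq_star_mul_self.mp (nonneg_iff_posSemidef.mpr hX)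
  have e : ((star C * C) ⊗ₖ (1 : Matrix n n ℂ)) * ρ =
      (Cᴴ ⊗ₖ (1 : Matrix n n ℂ)) * ((C ⊗ₖ (1 : Matrix n n ℂ)) * ρ) := by
    rw [← Matrix.mul_assoc, ← mul_kronecker_mul, Matrix.mul_one, star_eq_conjTranspose]
  rw [e, partialTraceLeft_kronecker_one_mul_comm]
  have h := hρ.mul_mul_conjTranspose_same (C ⊗ₖ (1 : Matrix n n ℂ))
  rw [conjTranspose_kronecker, conjTranspose_one] at h
  exact posSemidef_partialTraceLeft h

/-- Both sides are linear in `ρ`, so elementary tensors suffice. -/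
lemma tensorId_holevoMap [DecidableEq m] {m' κ : Type*} [Fintype m'] [DecidableEq m'] [Fintype κ]
    (R : κ → Matrix m' m' ℂ) (X : κ → Matrix m m ℂ) (ρ : Matrix (m × n) (m × n) ℂ) :
    tensorId n (holevoMap R X) ρ =
      ∑ k, R k ⊗ₖ partialTraceLeft ((X k ⊗ₖ (1 : Matrix n n ℂ)) * ρ) := by
  obtain ⟨t, rfl⟩ := (kroneckerLinearEquiv m m n n ℂ).surjective ρ
  induction t with
  | zero =>
    have : partialTraceLeft (0 : Matrix (m × n) (m × n) ℂ) = 0 := by ext; simp [partialTraceLeft]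
    simp [this]
  | add s t hs ht =>
    have (A B : Matrix (m × n) (m × n) ℂ) :
        partialTraceLeft (A + B) = partialTraceLeft A + partialTraceLeft B := by
      ext; simp [partialTraceLeft, Finset.sum_add_distrib]
    simp only [map_add, Matrix.mul_add, this, kronecker_add, Finset.sum_add_distrib, hs, ht]
  | tmul A B =>
    have (C : Matrix m m ℂ) : partialTraceLeft (C ⊗ₖ B) = C.trace • B := by
      ext; simp [partialTraceLeft, trace, Finset.sum_mul]
    simp only [tensorId, LinearMap.comp_apply, LinearEquiv.coe_coe, kroneckerLinearEquiv_tmul,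
      ← mul_kronecker_mul, Matrix.one_mul, this]
    ext ⟨i, a⟩ ⟨j, b⟩
    simp [holevoMap, Matrix.sum_apply, Finset.sum_mul]
    exact Finset.sum_congr rfl fun k _ => by ring

end PartialTrace

end EBChannel

/-! ### Trace inequality for `T A T*` -/

namespace Matrix

variable {n : Type*} [Fintype n] [DecidableEq n] {A : Matrix n n ℂ}

lemma posSemidef_rpow (A : Matrix n n ℂ) (p : ℝ) : (A ^ p).PosSemidef :=
  nonneg_iff_posSemidef.mp CFC.rpow_nonneg

lemma PosSemidef.rpow_half_mul_self (hA : A.PosSemidef) :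
    A ^ (1 / 2 : ℝ) * A ^ (1 / 2 : ℝ) = A := by
  rw [hA.rpow_eq_spectralMap one_half_pos, ← hA.isHermitian.spectralMap_posCpow_add,
    ← Complex.ofReal_add, add_halves, Complex.ofReal_one, hA.spectralMap_posCpow_one]

/-- Apply the `Y Y*`, `Y* Y` exchange to `Y = T A^(1/2)`; this is what admits a rectangular `T`. -/
lemma PosSemidef.trace_rpow_mul_mul_conjTranspose_le {m : Type*} [Fintype m] [DecidableEq m]
    (hA : A.PosSemidef) (T : Matrix m n ℂ) {p : ℝ} (hp : 1 ≤ p) :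
    ((T * A * Tᴴ) ^ p).trace ≤ (A ^ p * (Tᴴ * T) ^ p).trace := by
  have hE : (A ^ (1 / 2 : ℝ))ᴴ = A ^ (1 / 2 : ℝ) := (posSemidef_rpow A _).isHermitian
  have e : T * A * Tᴴ = (T * A ^ (1 / 2 : ℝ)) * (T * A ^ (1 / 2 : ℝ))ᴴ := by
    rw [conjTranspose_mul, hE, ← Matrix.mul_assoc, Matrix.mul_assoc T (A ^ (1 / 2 : ℝ)),
      hA.rpow_half_mul_self]
  rw [e, trace_rpow_mul_conjTranspose_self _ (by linarith)]
  refine le_of_eq_of_le ?_ (hA.trace_rpow_le (posSemidef_conjTranspose_mul_self T) hp)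
  rw [conjTranspose_mul, hE]
  simp only [Matrix.mul_assoc]

end Matrix

/-! ### Block factorization of the output -/

namespace EBChannel

open Matrix

variable {m' n κ : Type*} [Fintype m'] [DecidableEq m'] [Fintype n] [DecidableEq n] [Fintype κ]
  [DecidableEq κ]

lemma blockRow_mul_blockDiagonal_mul_conjTranspose {x : κ → ℂ} {R : κ → Matrix m' m' ℂ}
    (hR : ∀ k, (x k • R k).PosSemidef) (G : κ → Matrix n n ℂ) :
    ((1 : Matrix n n ℂ) ⊗ₖ blockRow x R) * blockDiagonal (fun q : κ × m' => G q.1) *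
      ((1 : Matrix n n ℂ) ⊗ₖ blockRow x R)ᴴ = ∑ k, G k ⊗ₖ (x k • R k) := by
  ext ⟨a, i⟩ ⟨b, j⟩
  have h (k : κ) : (x k • R k) i j = ∑ l, ((x k • R k) ^ (1 / 2 : ℝ)) i l *
      star (((x k • R k) ^ (1 / 2 : ℝ)) j l) := by
    conv_lhs => rw [← (hR k).rpow_half_mul_self]
    rw [mul_apply]
    refine Finset.sum_congr rfl fun l _ => ?_
    rw [(posSemidef_rpow (x k • R k) _).isHermitian.apply]
  simp only [Matrix.sum_apply, kroneckerMap_apply, h]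
  simp only [mul_apply, conjTranspose_apply, kroneckerMap_apply, blockDiagonal_apply, one_apply,
    Fintype.sum_prod_type, blockRow, of_apply, Prod.mk.injEq]
  simp only [ite_and, Finset.mul_sum, ite_mul, one_mul, zero_mul, mul_ite, mul_zero,
    Finset.sum_ite_irrel, Finset.sum_const_zero, Finset.sum_ite_eq, Finset.sum_ite_eq',
    Finset.mem_univ, if_true, apply_ite star, star_zero]
  exact Finset.sum_congr rfl fun k _ => Finset.sum_congr rfl fun l _ => by ring

lemma trace_diagBlock_rpow_eq_zero {x : κ → ℂ} {R : κ → Matrix m' m' ℂ} {k : κ} (hk : x k = 0)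
    {p : ℝ} (hp : 0 < p) :
    (diagBlock (((blockRow x R)ᴴ * blockRow x R) ^ p) k).trace = 0 := by
  have h0 (i j : m') : blockRow x R i (k, j) = 0 := by
    have := CFC.zero_rpow (A := Matrix m' m' ℂ) (x := 1 / 2) (by norm_num)
    rw [CFC.rpow_eq_pow] at this
    simp only [blockRow, of_apply, hk, zero_smul, this, Matrix.zero_apply]
  refine Finset.sum_eq_zero fun i _ => ?_
  exact (posSemidef_conjTranspose_mul_self (blockRow x R)).rpow_apply_eq_zero hp
    (fun j => by simp [mul_apply, h0]) _

lemma trace_blockDiagonal_mul_one_kronecker (G : κ → Matrix n n ℂ)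
    (S : Matrix (κ × m') (κ × m') ℂ) :
    (blockDiagonal (fun q : κ × m' => G q.1) * ((1 : Matrix n n ℂ) ⊗ₖ S)).trace =
      ∑ k, (diagBlock S k).trace * (G k).trace := by
  simp only [trace, diag_apply, diagBlock, of_apply, mul_apply, blockDiagonal_apply,
    kroneckerMap_apply, one_apply, Fintype.sum_prod_type, ite_mul, zero_mul, Prod.mk.injEq, ite_and]
  simp only [one_mul, mul_ite, mul_zero, Finset.sum_ite_irrel, Finset.sum_const_zero,
    Finset.sum_ite_eq, Finset.sum_ite_eq', Finset.mem_univ, if_true, Finset.sum_mul_sum]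
  rw [Finset.sum_comm]
  refine Finset.sum_congr rfl fun k _ => ?_
  rw [Finset.sum_comm]
  simp only [mul_comm]

end EBChannel

/-! ### The main inequality -/

theorem lemma2 {m m' n κ : Type*} [Fintype m] [DecidableEq m] [Fintype m'] [DecidableEq m']
    [Fintype n] [DecidableEq n] [Fintype κ] [DecidableEq κ]
    (R : κ → Matrix m' m' ℂ) (X : κ → Matrix m m ℂ) (ρ₁₂ : Matrix (m × n) (m × n) ℂ)
    (hR : ∀ k, EBChannel.IsDensity (R k)) (hX : EBChannel.IsPOVM X)
    (hρ : EBChannel.IsDensity ρ₁₂)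
    (x : κ → ℂ) (hx : ∀ k, x k = ((X k ⊗ₖ (1 : Matrix n n ℂ)) * ρ₁₂).trace)
    (G : κ → Matrix n n ℂ)
    (hG : ∀ k, x k ≠ 0 →
      G k = (x k)⁻¹ • EBChannel.partialTraceLeft ((X k ⊗ₖ (1 : Matrix n n ℂ)) * ρ₁₂))
    (p : ℝ) (hp : 1 ≤ p) :
    (EBChannel.tensorId n (EBChannel.holevoMap R X) ρ₁₂ ^ p).trace ≤
      ∑ k, (EBChannel.diagBlock
          (((EBChannel.blockRow x R).conjTranspose * EBChannel.blockRow x R) ^ p) k).trace *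
        (G k ^ p).trace := by
  open Matrix EBChannel in
  have hp0 : 0 < p := by linarith
  let P k := partialTraceLeft ((X k ⊗ₖ (1 : Matrix n n ℂ)) * ρ₁₂)
  have hP k : (P k).PosSemidef :=
    posSemidef_partialTraceLeft_kronecker_one_mul (hX.posSemidef k) hρ.posSemidef
  have hxP k : x k = (P k).trace := by rw [hx, trace_partialTraceLeft]
  have hx0 k : 0 ≤ x k := hxP k ▸ (hP k).trace_nonneg
  -- Since `0⁻¹ = 0`, this vanishes when `x k = 0`, so it is positive semidefinite for all `k`,
  -- unlike the arbitrary `G k`.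
  let G' k := (x k)⁻¹ • P k
  have hG' k : (G' k).PosSemidef := (hP k).smul (inv_nonneg.mpr (hx0 k))
  have hPG k : P k = x k • G' k := by
    by_cases h : x k = 0
    -- A positive semidefinite matrix of trace zero is zero.
    · rw [h, zero_smul, ← (hP k).trace_eq_zero_iff, ← hxP, h]
    · rw [smul_inv_smul₀ h]
  have hxR k : (x k • R k).PosSemidef := (hR k).posSemidef.smul (hx0 k)
  have hsum : (∑ k, G' k ⊗ₖ (x k • R k)).submatrix (Equiv.prodComm m' n) (Equiv.prodComm m' n) =
      tensorId n (holevoMap R X) ρ₁₂ := by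
    rw [tensorId_holevoMap]
    ext ⟨i, a⟩ ⟨j, b⟩
    simp only [submatrix_apply, Matrix.sum_apply, Equiv.prodComm_apply, Prod.swap_prod_mk,
      kroneckerMap_apply]
    refine Finset.sum_congr rfl fun k _ => ?_
    change _ = R k i j * P k a b
    rw [hPG k]
    simp only [Matrix.smul_apply, smul_eq_mul]
    ring
  rw [← hsum, PosSemidef.trace_rpow_submatrix
    (posSemidef_sum _ fun k _ => (hG' k).kronecker (hxR k)),
    ← blockRow_mul_blockDiagonal_mul_conjTranspose hxR]
  refine ((posSemidef_blockDiagonal fun q : κ × m' =>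
    hG' q.1).trace_rpow_mul_mul_conjTranspose_le _ hp).trans_eq ?_
  rw [blockDiagonal_rpow fun q : κ × m' => hG' q.1, conjTranspose_kronecker, conjTranspose_one,
    ← mul_kronecker_mul, Matrix.one_mul, (posSemidef_conjTranspose_mul_self _).one_kronecker_rpow,
    trace_blockDiagonal_mul_one_kronecker fun k => G' k ^ p]
  refine Finset.sum_congr rfl fun k _ => ?_
  -- `G` and `G'` may differ only where the block of `(R* R)^p` has zero trace.
  by_cases h : x k = 0
  · rw [trace_diagBlock_rpow_eq_zero h hp0, zero_mul, zero_mul]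
  · rw [hG k h]
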